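/- For $z\in\mathbb C\setminus\,]-\infty,0]$ let $\sqrt z$ be the principal square root (positive on the positive real axis). For an integer $k\ge 1$ and $\varsigma\in\mathbb C\setminus[1,\infty[$ put $$b(\varsigma)=\frac{1-\sqrt{1-\varsigma}}{1+\sqrt{1-\varsigma}},\qquad g_k(\varsigma)=\bigl(\sqrt{1-\varsigma}\bigr)^{k+1}\sum_{f=1}^{\infty} f^k\,\frac{b(\varsigma)^f}{1-b(\varsigma)^f}.$$ Let $U=\{\varsigma\in\mathbb C:|\varsigma|<1\}$ and let $\bar U$ be its closure; $\delta_{k,1}$ is the Kronecker symbol and $\zeta$ the Riemann zeta function. Theorem. There are complex constants $\lambda_l(k),\tilde\lambda_l(k)$ (for $l,k\ge1$), depending only on $l$ and $k$, such that for every integer $M\ge2$ and every integer $k\ge1$ the following holds. The series defining $g_k$ converges absolutely at every point of $U$, and the function $\wp_k:U\to\mathbb C$, $$\wp_k(\varsigma)=g_k(\varsigma)-\frac{k!\,\zeta(k+1)}{2^{k+1}}+\sum_{l=1}^{M}\lambda_l(k)(1-\varsigma)^l+\delta_{k,1}\sqrt{1-\varsigma}\,\Bigl(\frac14+\sum_{l=1}^{M}\tilde\lambda_l(k)(1-\varsigma)^l\Bigr),$$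 is holomorphic on $U$. Moreover, for every $0\le m\le M$, the $m$-th derivative $\wp_k^{(m)}$ extends to a continuous function on $\bar U$ that takes the value $0$ at $\varsigma=1$. -/

import Mathlib

namespace ClosedWalk

noncomputable section

/-- `b(ς) = (1 - √(1 - ς)) / (1 + √(1 - ς))`, with the principal branch
of the square root. -/
def b (ς : ℂ) : ℂ := (1 - Complex.sqrt (1 - ς)) / (1 + Complex.sqrt (1 - ς))

/-- The `f`-th term `f ^ k * b(ς) ^ f / (1 - b(ς) ^ f)` of the Lambert series. -/
def lambertTerm (k : ℕ) (ς : ℂ) (f : ℕ) : ℂ := (f : ℂ) ^ k * (b ς ^ f / (1 - b ς ^ f))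

/-- `g_k(ς) = (√(1 - ς)) ^ (k + 1) * ∑_{f ≥ 1} f ^ k * b(ς) ^ f / (1 - b(ς) ^ f)`; the
summation variable is shifted so that `f + 1` runs through `1, 2, 3, …`. -/
def g (k : ℕ) (ς : ℂ) : ℂ := Complex.sqrt (1 - ς) ^ (k + 1) * ∑' f : ℕ, lambertTerm k ς (f + 1)

/-- The function `℘_k`: `g_k` minus the constant `k! ζ(k+1) / 2 ^ (k+1)`, corrected by a
polynomial of degree at most `M` in `1 - ς` and, for `k = 1` only, by `√(1 - ς)` times a
polynomial in `1 - ς` with constant term `1 / 4`.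
Here `lam l` and `lam' l` are the coefficients of `(1 - ς) ^ l`. -/
def wp (M k : ℕ) (lam lam' : ℕ → ℂ) (ς : ℂ) : ℂ :=
  g k ς - (k.factorial : ℂ) * riemannZeta ((k : ℂ) + 1) / 2 ^ (k + 1)
    + ∑ l ∈ Finset.Icc 1 M, lam l * (1 - ς) ^ l
    + (if k = 1 then 1 else 0) *
        (Complex.sqrt (1 - ς) * (1 / 4 + ∑ l ∈ Finset.Icc 1 M, lam' l * (1 - ς) ^ l))

end

end ClosedWalk

open Complex MeasureTheory Set Filter Topology Asymptotics

namespace ClosedWalk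

noncomputable section

/-! Put z = 1 - ς, w = √z, and let H be the even function `logQuot`, so that b(ς) = exp(-s) with s =
w H(z) for small z. Then g_k = H(z)^(-(k+1)) · s · ∑ φ(f s), where φ(x) = x^k / (e^x - 1) is `bose
k` (`g_eq`). Euler–Maclaurin along the ray through s (`tsum_bose_eq`, `lambert_asymptotic`) expands
s ∑ φ(f s) in even powers of s. The only odd term is -s φ(0)/2, which survives just for k = 1. Since
s^2 = z H(z)^2, the even part is analytic in z and the odd part is w times an analytic function of
z. Subtracting their Taylor polynomials defines the coefficients, and what remains is O(|w|^(2M+1))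
in a sector (`exists_norm_wp_le`). Cauchy's estimate on a disc of radius |z|/4 costs |w|^(-2) per
derivative, so derivatives of order m ≤ M are O(|w|) at ς = 1 (`exists_norm_iteratedDeriv_wp_le`).
The function is holomorphic off [1, ∞), so 1 is the only point of the closed disc needing this
argument. -/

/-! ### Laplace integrals of powers. -/

lemma norm_pow_mul_exp_neg (k : ℕ) (a : ℂ) {t : ℝ} (ht : 0 < t) :
    ‖(t : ℂ) ^ k * exp (-a * t)‖ = t ^ (k : ℝ) * Real.exp (-a.re * t ^ (1 : ℝ)) := by
  simp [Complex.norm_exp, abs_of_pos ht]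

lemma integrableOn_pow_mul_exp_neg (k : ℕ) {a : ℂ} (ha : 0 < a.re) :
    IntegrableOn (fun t : ℝ => (t : ℂ) ^ k * exp (-a * t)) (Ioi 0) := by
  refine (integrableOn_rpow_mul_exp_neg_mul_rpow (p := 1) (s := k) (b := a.re)
    (by have := k.cast_nonneg (α := ℝ); linarith) one_pos ha).mono'
    (Continuous.aestronglyMeasurable (by fun_prop)) ?_
  filter_upwards [ae_restrict_mem measurableSet_Ioi] with t ht
  exact (norm_pow_mul_exp_neg k a ht).le

lemma tendsto_pow_mul_exp_neg (k : ℕ) {a : ℂ} (ha : 0 < a.re) :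
    Tendsto (fun t : ℝ => (t : ℂ) ^ k * exp (-a * t)) atTop (𝓝 0) := by
  rw [tendsto_zero_iff_norm_tendsto_zero]
  have h := tendsto_rpow_mul_exp_neg_mul_atTop_nhds_zero (k : ℝ) a.re ha
  refine h.congr' ?_
  filter_upwards [eventually_gt_atTop 0] with t ht
  rw [norm_pow_mul_exp_neg k a ht, Real.rpow_one]

lemma integral_pow_mul_exp_neg (k : ℕ) {a : ℂ} (ha : 0 < a.re) :
    ∫ t : ℝ in Ioi 0, (t : ℂ) ^ k * exp (-a * t) = k.factorial / a ^ (k + 1) := by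
  have ha0 : a ≠ 0 := fun h => by simp [h] at ha
  have hexp : ∀ t : ℝ, HasDerivAt (fun t : ℝ => exp (-a * t) / (-a)) (exp (-a * t)) t := by
    intro t
    have h : HasDerivAt (fun t : ℝ => (-a) * (t : ℂ)) (-a) t := by
      simpa using (hasDerivAt_id t).ofReal_comp.const_mul (-a)
    exact (h.cexp.div_const (-a)).congr_deriv (mul_div_cancel_right₀ _ (neg_ne_zero.2 ha0))
  induction k with
  | zero =>
    have h := integral_Ioi_of_hasDerivAt_of_tendsto' (a := 0) (fun t _ => hexp t)
      (by simpa using integrableOn_pow_mul_exp_neg 0 ha)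
      (by simpa using (tendsto_pow_mul_exp_neg 0 ha).div_const (-a))
    simp only [pow_zero, one_mul, h]
    simp
  | succ k ih =>
    have hpow : ∀ t : ℝ, HasDerivAt (fun t : ℝ => (t : ℂ) ^ (k + 1)) ((k + 1 : ℂ) * t ^ k) t := by
      intro t
      simpa using ((hasDerivAt_id t).ofReal_comp.fun_pow (k + 1))
    have h := integral_Ioi_mul_deriv_eq_deriv_mul (a := (0 : ℝ)) (a' := (0 : ℂ)) (b' := (0 : ℂ))
      (u := fun t : ℝ => (t : ℂ) ^ (k + 1)) (v := fun t : ℝ => exp (-a * t) / (-a))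
      (fun t _ => hpow t) (fun t _ => hexp t) (integrableOn_pow_mul_exp_neg (k + 1) ha) ?_ ?_ ?_
    · rw [h]
      have : ∀ t : ℝ, (k + 1 : ℂ) * (t : ℂ) ^ k * (exp (-a * t) / (-a))
          = ((k + 1 : ℂ) / (-a)) * ((t : ℂ) ^ k * exp (-a * t)) := fun t => by ring
      simp_rw [this]
      rw [integral_const_mul, ih, Nat.factorial_succ]
      push_cast
      field_simp
      ring
    · refine ((integrableOn_pow_mul_exp_neg k ha).const_mul ((k + 1 : ℂ) / (-a))).congr ?_
      exact Eventually.of_forall fun t => by simp only [Pi.mul_apply]; ring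
    · have hc : Continuous ((fun t : ℝ => (t : ℂ) ^ (k + 1)) *
          fun t : ℝ => exp (-a * t) / (-a)) := by
        apply Continuous.mul <;> fun_prop
      have := (hc.tendsto 0).mono_left (nhdsWithin_le_nhds (s := Ioi 0))
      simpa using this
    · have := (tendsto_pow_mul_exp_neg (k + 1) ha).div_const (-a)
      simp only [zero_div] at this
      exact this.congr fun t => by simp only [Pi.mul_apply]; ring

/-! ### The Bose function and the decay of its derivatives in sectors. -/

/-- The function `x ^ k / (exp x - 1)`, continued analytically to `x = 0` (for `k ≥ 1`). -/
def bose (k : ℕ) (x : ℂ) : ℂ := x ^ (k - 1) / dslope exp 0 x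

/-- The domain of holomorphy of `bose k`. -/
def boseDomain : Set ℂ := {x | dslope exp 0 x ≠ 0}

lemma differentiable_dslope_exp : Differentiable ℂ (dslope exp 0) := by
  rw [← differentiableOn_univ, Complex.differentiableOn_dslope univ_mem]
  exact Complex.differentiable_exp.differentiableOn

lemma isOpen_boseDomain : IsOpen boseDomain :=
  isOpen_ne_fun differentiable_dslope_exp.continuous continuous_const

lemma dslope_exp_of_ne {x : ℂ} (hx : x ≠ 0) : dslope exp 0 x = (exp x - 1) / x := by
  rw [dslope_of_ne _ hx, slope_def_field]
  simp

lemma exp_sub_one_ne_zero {x : ℂ} (hx : 0 < x.re) : exp x - 1 ≠ 0 := by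
  intro h
  have h1 : ‖exp x‖ = 1 := by rw [sub_eq_zero.1 h]; simp
  rw [Complex.norm_exp, Real.exp_eq_one_iff] at h1
  exact hx.ne' h1

lemma mem_boseDomain_of_re_pos {x : ℂ} (hx : 0 < x.re) : x ∈ boseDomain := by
  have hx0 : x ≠ 0 := fun h => by simp [h] at hx
  simp only [boseDomain, mem_ofPred_eq, dslope_exp_of_ne hx0]
  exact div_ne_zero (exp_sub_one_ne_zero hx) hx0

lemma zero_mem_boseDomain : (0 : ℂ) ∈ boseDomain := by
  simp [boseDomain, dslope_same]

lemma mem_boseDomain_of_mem_sector {K : ℝ} {x : ℂ} (hx : ‖x‖ ≤ K * x.re) (hK : 0 < K) :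
    x ∈ boseDomain := by
  by_cases h : x = 0
  · exact h ▸ zero_mem_boseDomain
  · exact mem_boseDomain_of_re_pos (pos_of_mul_pos_right ((norm_pos_iff.2 h).trans_le hx) hK.le)

lemma differentiableOn_bose (k : ℕ) : DifferentiableOn ℂ (bose k) boseDomain :=
  DifferentiableOn.div (by fun_prop) differentiable_dslope_exp.differentiableOn fun _ hx => hx

lemma analyticOnNhd_bose (k : ℕ) : AnalyticOnNhd ℂ (bose k) boseDomain :=
  (differentiableOn_bose k).analyticOnNhd isOpen_boseDomain

lemma bose_of_ne {k : ℕ} (hk : 1 ≤ k) {x : ℂ} (hx : x ≠ 0) :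
    bose k x = x ^ k / (exp x - 1) := by
  obtain ⟨k, rfl⟩ := Nat.exists_eq_add_of_le' hk
  rw [bose, dslope_exp_of_ne hx, Nat.add_sub_cancel, pow_succ]
  field_simp

/-- This value is the source of the Kronecker symbol in the theorem. -/
lemma bose_zero {k : ℕ} (hk : 1 ≤ k) : bose k 0 = if k = 1 then 1 else 0 := by
  obtain ⟨k, rfl⟩ := Nat.exists_eq_add_of_le' hk
  rcases k with _ | k <;> simp [bose, dslope_same]

/-- A single Taylor term bounds e^x - 1 from below. The exponent k + 2 is chosen so that in a sector
the quotient decays like |x|^(-2), which is summable. -/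
lemma norm_bose_le {k : ℕ} (hk : 1 ≤ k) {x : ℂ} (hx : 0 < x.re) :
    ‖bose k x‖ ≤ ‖x‖ ^ k * ((k + 2).factorial / x.re ^ (k + 2)) := by
  have hx0 : x ≠ 0 := fun h => by simp [h] at hx
  rw [bose_of_ne hk hx0, norm_div, norm_pow, div_eq_mul_inv]
  refine mul_le_mul_of_nonneg_left ?_ (by positivity)
  rw [← inv_div]
  have h1 : x.re ^ (k + 2) / (k + 2).factorial ≤ Real.exp x.re - 1 := by
    have h := Real.sum_le_exp_of_nonneg hx.le (k + 3)
    rw [Finset.sum_range_succ, Finset.sum_range_succ'] at h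
    have h0 : 0 ≤ ∑ i ∈ Finset.range (k + 1), x.re ^ (i + 1) / ((i + 1).factorial : ℝ) :=
      Finset.sum_nonneg fun i _ => by positivity
    simp only [pow_zero, Nat.factorial_zero, Nat.cast_one, div_one] at h
    linarith
  have h2 : Real.exp x.re - 1 ≤ ‖exp x - 1‖ := by
    have := norm_sub_norm_le (exp x) 1
    rwa [Complex.norm_exp, norm_one] at this
  exact inv_anti₀ (by positivity) (h1.trans h2)

/-- Compactness handles |x| ≤ 1. For |x| ≥ 1, a disc of fixed radius 1/(2K) around x stays in the
right half-plane, and Cauchy's estimate transfers the decay of the function to its derivatives. -/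
lemma exists_norm_iteratedDeriv_bose_le {k : ℕ} (hk : 1 ≤ k) {K : ℝ} (hK : 1 ≤ K) (n : ℕ) :
    ∃ C, 0 ≤ C ∧ ∀ x : ℂ, ‖x‖ ≤ K * x.re →
      ‖iteratedDeriv n (bose k) x‖ ≤ C / (1 + ‖x‖ ^ 2) := by
  have hK0 : 0 < K := by linarith
  have hcpt : IsCompact ({x : ℂ | ‖x‖ ≤ K * x.re} ∩ Metric.closedBall 0 1) := by
    refine (isCompact_closedBall 0 1).inter_left ?_
    exact isClosed_le continuous_norm (by fun_prop)
  have hcont : ContinuousOn (iteratedDeriv n (bose k)) boseDomain := by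
    rw [iteratedDeriv_eq_iterate]
    exact ((analyticOnNhd_bose k).iterated_deriv n).continuousOn
  obtain ⟨C₁, hC₁⟩ := hcpt.exists_bound_of_continuousOn
    (hcont.mono fun x hx => mem_boseDomain_of_mem_sector hx.1 hK0)
  have hC₁0 : 0 ≤ C₁ := (norm_nonneg _).trans
    (hC₁ 0 ⟨by simp, by simp⟩)
  -- This comes from `norm_bose_le` on the circle, where |y| ≤ 2|x| and Re y ≥ |x|/(2K).
  set B : ℝ := 2 ^ k * ((k + 2).factorial * (2 * K) ^ (k + 2)) with hB
  have hB0 : 0 ≤ B := by positivity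
  set C₂ : ℝ := n.factorial * B / (1 / (2 * K)) ^ n with hC₂
  have hC₂0 : 0 ≤ C₂ := by positivity
  refine ⟨2 * (C₁ + C₂), by positivity, fun x hx => ?_⟩
  rw [le_div_iff₀ (by positivity)]
  rcases le_total ‖x‖ 1 with h1 | h1
  · have := hC₁ x ⟨hx, by simpa using h1⟩
    have h2 : 1 + ‖x‖ ^ 2 ≤ 2 := by nlinarith [norm_nonneg x]
    calc _ ≤ C₁ * 2 := by gcongr
      _ ≤ _ := by linarith
  · have hre : ‖x‖ / K ≤ x.re := by rw [div_le_iff₀ hK0]; linarith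
    have hball : ∀ y ∈ Metric.closedBall x (1 / (2 * K)), ‖x‖ / (2 * K) ≤ y.re := by
      intro y hy
      rw [Metric.mem_closedBall, dist_eq_norm] at hy
      have h3 := (abs_le.1 ((Complex.abs_re_le_norm (y - x)).trans hy)).1
      rw [sub_re] at h3
      have h4 : 1 / (2 * K) ≤ ‖x‖ / (2 * K) := by gcongr
      have h5 : ‖x‖ / K = ‖x‖ / (2 * K) + ‖x‖ / (2 * K) := by field_simp; ring
      linarith
    have hpos : 0 < ‖x‖ / (2 * K) := by positivity
    have hd := Complex.norm_iteratedDeriv_le_of_forall_mem_sphere_norm_le (c := x)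
      (R := 1 / (2 * K)) (C := B / ‖x‖ ^ 2) (f := bose k) n (by positivity)
      ((differentiableOn_bose k).mono (by
        intro y hy
        refine mem_boseDomain_of_re_pos (hpos.trans_le (hball y ?_))
        exact Metric.closure_ball_subset_closedBall hy)).diffContOnCl
      (by
        intro y hy
        have hy' := Metric.sphere_subset_closedBall hy
        have hyre := hball y hy'
        have hyn : ‖y‖ ≤ 2 * ‖x‖ := by
          rw [Metric.mem_closedBall, dist_eq_norm] at hy'
          have h6 : ‖y‖ ≤ ‖x‖ + ‖y - x‖ := by
            have := norm_add_le x (y - x); simpa using this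
          have h7 : 1 / (2 * K) ≤ 1 := by rw [div_le_one (by positivity)]; linarith
          linarith
        refine (norm_bose_le hk (hpos.trans_le hyre)).trans ?_
        calc ‖y‖ ^ k * ((k + 2).factorial / y.re ^ (k + 2))
            ≤ (2 * ‖x‖) ^ k * ((k + 2).factorial / (‖x‖ / (2 * K)) ^ (k + 2)) := by
              have hyre0 := hpos.trans_le hyre
              gcongr
          _ = B / ‖x‖ ^ 2 := by
              have hx0 : ‖x‖ ≠ 0 := by positivity
              rw [hB, div_pow, mul_pow]
              field_simp
              ring)
    have h8 : (n.factorial : ℝ) * (B / ‖x‖ ^ 2) / (1 / (2 * K)) ^ n = C₂ / ‖x‖ ^ 2 := by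
      rw [hC₂]; ring
    rw [h8] at hd
    have h9 : 1 + ‖x‖ ^ 2 ≤ 2 * ‖x‖ ^ 2 := by nlinarith
    calc _ ≤ C₂ / ‖x‖ ^ 2 * (2 * ‖x‖ ^ 2) := by gcongr
      _ = 2 * C₂ := by
        have hx0 : ‖x‖ ≠ 0 := by positivity
        field_simp
      _ ≤ _ := by linarith

/-! ### Euler–Maclaurin summation. -/

/-- The `f`-th piece of the `n`-th Euler–Maclaurin integral of the sequence `u` of successive
derivatives. -/
def emTerm (u : ℕ → ℝ → ℂ) (n f : ℕ) : ℂ :=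
  ∫ t : ℝ in 0..1, ((bernoulliFun n t / n.factorial : ℝ) : ℂ) * u n (t + f)

section EulerMaclaurin

variable {u : ℕ → ℝ → ℂ}

lemma hasDerivAt_bernoulliFun_div (n : ℕ) (t : ℝ) :
    HasDerivAt (fun t : ℝ => ((bernoulliFun (n + 1) t / (n + 1).factorial : ℝ) : ℂ))
      ((bernoulliFun n t / n.factorial : ℝ) : ℂ) t := by
  refine (((hasDerivAt_bernoulliFun (n + 1) t).div_const _).congr_deriv ?_).ofReal_comp
  rw [Nat.factorial_succ]
  push_cast
  have h1 : (n : ℝ) + 1 ≠ 0 := by positivity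
  have h2 : (n.factorial : ℝ) ≠ 0 := by positivity
  field_simp

/-- Integration by parts, with B_(n+1)/(n+1)! as antiderivative of B_n/n!. -/
lemma emTerm_eq (hu : ∀ n t, 0 ≤ t → HasDerivAt (u n) (u (n + 1) t) t) (n f : ℕ) :
    emTerm u n f = ((bernoulliFun (n + 1) 1 / (n + 1).factorial : ℝ) : ℂ) * u n (f + 1)
      - ((bernoulliFun (n + 1) 0 / (n + 1).factorial : ℝ) : ℂ) * u n f - emTerm u (n + 1) f := by
  have hd : ∀ m : ℕ, ∀ t ∈ uIcc (0 : ℝ) 1,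
      HasDerivAt (fun t : ℝ => u m (t + f)) (u (m + 1) (t + f)) t := by
    intro m t ht
    rw [uIcc_of_le zero_le_one] at ht
    exact (hu m (t + f) (add_nonneg ht.1 f.cast_nonneg)).comp_add_const t f
  have h := intervalIntegral.integral_mul_deriv_eq_deriv_mul (a := (0 : ℝ)) (b := 1)
    (u := fun t : ℝ => u n (t + f)) (u' := fun t : ℝ => u (n + 1) (t + f))
    (hd n) (fun t _ => hasDerivAt_bernoulliFun_div n t)
    (ContinuousOn.intervalIntegrable fun t ht => (hd (n + 1) t ht).continuousAt.continuousWithinAt)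
    (Continuous.intervalIntegrable (by fun_prop) _ _)
  simp only [emTerm]
  rw [intervalIntegral.integral_congr (g := fun t : ℝ => u n (t + f) *
    ((bernoulliFun n t / n.factorial : ℝ) : ℂ)) fun t _ => mul_comm _ _, h,
    intervalIntegral.integral_congr (g := fun t : ℝ => u (n + 1) (t + f) *
    ((bernoulliFun (n + 1) t / (n + 1).factorial : ℝ) : ℂ)) fun t _ => mul_comm _ _]
  rw [zero_add, add_comm (1 : ℝ)]
  ring

lemma emTerm_zero (hu : ∀ n t, 0 ≤ t → HasDerivAt (u n) (u (n + 1) t) t) (f : ℕ) :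
    emTerm u 0 f = (u 0 (f + 1) + u 0 f) / 2 - emTerm u 1 f := by
  rw [emTerm_eq hu]
  simp only [zero_add, bernoulliFun_one, Nat.factorial_one]
  push_cast
  ring

/-- From order 2 on, Bernoulli polynomials agree at 0 and 1, so the boundary terms telescope when
summed over f. -/
lemma emTerm_of_pos (hu : ∀ n t, 0 ≤ t → HasDerivAt (u n) (u (n + 1) t) t) {n : ℕ} (hn : 1 ≤ n)
    (f : ℕ) :
    emTerm u n f = ((bernoulliFun (n + 1) 0 / (n + 1).factorial : ℝ) : ℂ) * (u n (f + 1) - u n f)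
      - emTerm u (n + 1) f := by
  rw [emTerm_eq hu, bernoulliFun_endpoints_eq_of_ne_one (by omega)]
  ring

lemma exists_abs_bernoulliFun_div_le (n : ℕ) :
    ∃ B : ℝ, 0 ≤ B ∧ ∀ t ∈ Icc (0 : ℝ) 1, |bernoulliFun n t / n.factorial| ≤ B := by
  obtain ⟨B, hB⟩ := (isCompact_Icc (a := (0 : ℝ)) (b := 1)).exists_bound_of_continuousOn
    (f := fun t => bernoulliFun n t / n.factorial)
    (Continuous.continuousOn (by fun_prop))
  exact ⟨B, (norm_nonneg _).trans (hB 0 (by simp)), hB⟩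

lemma norm_emTerm_le {n : ℕ} {B D c : ℝ} (hB0 : 0 ≤ B) (hD0 : 0 ≤ D)
    (hB : ∀ t ∈ Icc (0 : ℝ) 1, |bernoulliFun n t / n.factorial| ≤ B)
    (hD : ∀ t, 0 ≤ t → ‖u n t‖ ≤ D / (1 + (c * t) ^ 2)) (f : ℕ) :
    ‖emTerm u n f‖ ≤ B * (D / (1 + (c * f) ^ 2)) := by
  have h := intervalIntegral.norm_integral_le_of_norm_le_const (a := (0 : ℝ)) (b := 1)
    (f := fun t : ℝ => ((bernoulliFun n t / n.factorial : ℝ) : ℂ) * u n (t + f))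
    (C := B * (D / (1 + (c * f) ^ 2))) ?_
  · simpa [emTerm] using h
  · intro t ht
    rw [uIoc_of_le zero_le_one] at ht
    have ht0 : 0 ≤ t := ht.1.le
    rw [norm_mul, Complex.norm_real, Real.norm_eq_abs]
    have h1 := hB t ⟨ht0, ht.2⟩
    have h2 : ‖u n (t + f)‖ ≤ D / (1 + (c * f) ^ 2) := by
      refine (hD _ (by positivity)).trans ?_
      gcongr 2
      rw [mul_pow, mul_pow]
      gcongr
      linarith
    gcongr

lemma summable_div_one_add_sq {c : ℝ} (hc : 0 < c) (D : ℝ) :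
    Summable fun f : ℕ => D / (1 + (c * f) ^ 2) := by
  have h : Summable fun f : ℕ => (1 / c ^ 2) * (1 / (f : ℝ) ^ 2) :=
    (Real.summable_one_div_nat_pow.2 one_lt_two).mul_left _
  have h2 : Summable fun f : ℕ => 1 / (1 + (c * f) ^ 2) := by
    refine Summable.of_norm_bounded_eventually_nat h ?_
    filter_upwards [eventually_gt_atTop 0] with f hf
    have hf' : (0 : ℝ) < f := by exact_mod_cast hf
    rw [Real.norm_of_nonneg (by positivity), one_div_mul_one_div, ← mul_pow]
    gcongr
    linarith
  simpa [div_eq_mul_inv] using h2.mul_left D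

variable {c : ℝ}

lemma summable_emTerm (hc : 0 < c)
    (hD : ∀ n, ∃ D, 0 ≤ D ∧ ∀ t, 0 ≤ t → ‖u n t‖ ≤ D / (1 + (c * t) ^ 2)) (n : ℕ) :
    Summable (emTerm u n) := by
  obtain ⟨B, hB0, hB⟩ := exists_abs_bernoulliFun_div_le n
  obtain ⟨D, hD0, hD⟩ := hD n
  exact Summable.of_norm_bounded ((summable_div_one_add_sq hc D).mul_left B)
    (norm_emTerm_le hB0 hD0 hB hD)

lemma summable_of_decay (hc : 0 < c)
    (hD : ∀ n, ∃ D, 0 ≤ D ∧ ∀ t, 0 ≤ t → ‖u n t‖ ≤ D / (1 + (c * t) ^ 2)) (n : ℕ) :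
    Summable fun f : ℕ => u n f := by
  obtain ⟨D, hD0, hD⟩ := hD n
  exact Summable.of_norm_bounded (summable_div_one_add_sq hc D) fun f => hD f f.cast_nonneg

lemma tsum_emTerm_of_pos (hu : ∀ n t, 0 ≤ t → HasDerivAt (u n) (u (n + 1) t) t) (hc : 0 < c)
    (hD : ∀ n, ∃ D, 0 ≤ D ∧ ∀ t, 0 ≤ t → ‖u n t‖ ≤ D / (1 + (c * t) ^ 2)) {n : ℕ} (hn : 1 ≤ n) :
    ∑' f, emTerm u n f = -((bernoulliFun (n + 1) 0 / (n + 1).factorial : ℝ) : ℂ) * u n 0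
      - ∑' f, emTerm u (n + 1) f := by
  have hs := summable_of_decay hc hD n
  have hs1 : Summable fun f : ℕ => u n ((f : ℝ) + 1) := by
    simpa using (summable_nat_add_iff 1).2 hs
  have h0 := hs.tsum_eq_zero_add
  simp only [Nat.cast_zero, Nat.cast_add, Nat.cast_one] at h0
  simp_rw [emTerm_of_pos hu hn]
  rw [((hs1.sub hs).mul_left _).tsum_sub (summable_emTerm hc hD (n + 1)), tsum_mul_left,
    hs1.tsum_sub hs, h0]
  ring

lemma tsum_emTerm_zero (hu : ∀ n t, 0 ≤ t → HasDerivAt (u n) (u (n + 1) t) t) (hc : 0 < c)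
    (hD : ∀ n, ∃ D, 0 ≤ D ∧ ∀ t, 0 ≤ t → ‖u n t‖ ≤ D / (1 + (c * t) ^ 2)) :
    ∑' f, emTerm u 0 f = ∑' f : ℕ, u 0 ((f : ℝ) + 1) + u 0 0 / 2 - ∑' f, emTerm u 1 f := by
  have hs := summable_of_decay hc hD 0
  have hs1 : Summable fun f : ℕ => u 0 ((f : ℝ) + 1) := by
    simpa using (summable_nat_add_iff 1).2 hs
  have h0 := hs.tsum_eq_zero_add
  simp only [Nat.cast_zero, Nat.cast_add, Nat.cast_one] at h0
  simp_rw [emTerm_zero hu]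
  rw [((hs1.add hs).div_const _).tsum_sub (summable_emTerm hc hD 1), tsum_div_const,
    hs1.tsum_add hs, h0]
  ring

/-- Each induction step integrates by parts twice; the second boundary term vanishes with the odd
Bernoulli number. Only odd derivatives at 0 remain, which later yields even powers of s. -/
lemma tsum_emTerm_one (hu : ∀ n t, 0 ≤ t → HasDerivAt (u n) (u (n + 1) t) t) (hc : 0 < c)
    (hD : ∀ n, ∃ D, 0 ≤ D ∧ ∀ t, 0 ≤ t → ‖u n t‖ ≤ D / (1 + (c * t) ^ 2)) (J : ℕ) :
    ∑' f, emTerm u 1 f = -∑ i ∈ Finset.range J,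
        ((bernoulliFun (2 * i + 2) 0 / (2 * i + 2).factorial : ℝ) : ℂ) * u (2 * i + 1) 0
      + ∑' f, emTerm u (2 * J + 1) f := by
  induction J with
  | zero => simp
  | succ J ih =>
    have hb : bernoulliFun (2 * J + 3) 0 = 0 := by
      rw [bernoulliFun_eval_zero, bernoulli_eq_zero_of_odd ⟨J + 1, by ring⟩ (by omega)]
      simp
    rw [ih, tsum_emTerm_of_pos hu hc hD (n := 2 * J + 1) (by omega),
      tsum_emTerm_of_pos hu hc hD (n := 2 * J + 1 + 1) (by omega), Finset.sum_range_succ, hb,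
      show 2 * (J + 1) + 1 = 2 * J + 1 + 1 + 1 by ring]
    simp only [zero_div, ofReal_zero, neg_zero, zero_mul]
    ring

lemma tsum_emTerm_zero_eq_integral (hu : ∀ n t, 0 ≤ t → HasDerivAt (u n) (u (n + 1) t) t)
    (hc : 0 < c)
    (hD : ∀ n, ∃ D, 0 ≤ D ∧ ∀ t, 0 ≤ t → ‖u n t‖ ≤ D / (1 + (c * t) ^ 2)) :
    ∑' f, emTerm u 0 f = ∫ t in Ioi (0 : ℝ), u 0 t := by
  have hcont : ∀ a b : ℝ, 0 ≤ a → a ≤ b → IntervalIntegrable (u 0) volume a b := by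
    intro a b ha hab
    refine ContinuousOn.intervalIntegrable fun t ht => ?_
    rw [uIcc_of_le hab] at ht
    exact (hu 0 t (ha.trans ht.1)).continuousAt.continuousWithinAt
  have hint : IntegrableOn (u 0) (Ioi 0) := by
    obtain ⟨D, hD0, hD⟩ := hD 0
    have h1 : Integrable fun t : ℝ => D * (1 + (c * t) ^ 2)⁻¹ :=
      (integrable_inv_one_add_sq.comp_mul_left' hc.ne').const_mul D
    refine h1.integrableOn.mono' ?_ ?_
    · refine ContinuousOn.aestronglyMeasurable (fun t ht => ?_) measurableSet_Ioi
      exact (hu 0 t (le_of_lt ht)).continuousAt.continuousWithinAt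
    · filter_upwards [ae_restrict_mem measurableSet_Ioi] with t ht
      exact hD t (le_of_lt ht)
  have hterm : ∀ f : ℕ, emTerm u 0 f = ∫ t in (f : ℝ)..((f + 1 : ℕ) : ℝ), u 0 t := by
    intro f
    simp [emTerm, add_comm]
  have h1 := (summable_emTerm hc hD 0).hasSum.tendsto_sum_nat
  have h2 : ∀ n : ℕ, ∑ f ∈ Finset.range n, emTerm u 0 f = ∫ t in (0 : ℝ)..n, u 0 t := by
    intro n
    simp_rw [hterm]
    rw [intervalIntegral.sum_integral_adjacent_intervals (a := fun n : ℕ => (n : ℝ))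
      fun k _ => hcont _ _ k.cast_nonneg (by simp)]
    simp
  simp_rw [h2] at h1
  exact tendsto_nhds_unique h1
    (intervalIntegral_tendsto_integral_Ioi 0 hint tendsto_natCast_atTop_atTop)

end EulerMaclaurin

/-! ### Expansion of the Lambert series at s = 0. -/

lemma re_pos_of_mem_sector {K : ℝ} (hK : 0 < K) {s : ℂ} (hs0 : s ≠ 0) (hs : ‖s‖ ≤ K * s.re) :
    0 < s.re :=
  pos_of_mul_pos_right ((norm_pos_iff.2 hs0).trans_le hs) hK.le

lemma hasSum_bose {k : ℕ} (hk : 1 ≤ k) {x : ℂ} (hx : 0 < x.re) :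
    HasSum (fun n : ℕ => x ^ k * exp (-(n + 1) * x)) (bose k x) := by
  have hx0 : x ≠ 0 := fun h => by simp [h] at hx
  have h1 : ‖exp (-x)‖ < 1 := by
    rw [Complex.norm_exp, Real.exp_lt_one_iff]
    simpa using hx
  have h := (hasSum_geometric_of_norm_lt_one h1).mul_left (x ^ k * exp (-x))
  convert! h using 1
  · funext n
    rw [mul_assoc, ← Complex.exp_nat_mul, ← Complex.exp_add]
    ring_nf
  · have h2 := exp_sub_one_ne_zero hx
    have h3 := Complex.exp_ne_zero x
    rw [bose_of_ne hk hx0, Complex.exp_neg]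
    have h4 : 1 - (exp x)⁻¹ ≠ 0 := by
      intro h
      apply h2
      field_simp at h
      simpa using h
    field_simp

/-- Expand the integrand as a geometric series and integrate termwise. Working with complex s
directly avoids rotating the contour. -/
lemma integral_bose {k : ℕ} (hk : 1 ≤ k) {s : ℂ} (hs : 0 < s.re) :
    ∫ t in Ioi (0 : ℝ), bose k (t * s) = k.factorial * riemannZeta (k + 1) / s := by
  have hs0 : s ≠ 0 := fun h => by simp [h] at hs
  have hre : ∀ n : ℕ, 0 < ((n + 1 : ℂ) * s).re := fun n => by
    have : ((n + 1 : ℂ) * s).re = (n + 1) * s.re := by simp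
    rw [this]; positivity
  let F : ℕ → ℝ → ℂ := fun n t => s ^ k * ((t : ℂ) ^ k * exp (-((n + 1) * s) * t))
  have hF : ∀ n, Integrable (F n) (volume.restrict (Ioi 0)) := fun n =>
    (integrableOn_pow_mul_exp_neg k (hre n)).const_mul _
  have hnorm : ∀ n, ∫ t in Ioi (0 : ℝ), ‖F n t‖ =
      ‖s‖ ^ k * (k.factorial / s.re ^ (k + 1)) * (1 / ((n : ℝ) + 1) ^ (k + 1)) := by
    intro n
    have hpos : 0 < (((n + 1) * s.re : ℝ) : ℂ).re := by
      rw [Complex.ofReal_re]; positivity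
    have h1 := integral_pow_mul_exp_neg k hpos
    have h2 : ∀ t : ℝ, (t : ℂ) ^ k * exp (-(((n + 1) * s.re : ℝ) : ℂ) * t)
        = ((t ^ k * Real.exp (-((n + 1) * s.re) * t) : ℝ) : ℂ) := fun t => by push_cast; rfl
    simp_rw [h2] at h1
    rw [integral_complex_ofReal] at h1
    have h3 : ∫ t in Ioi (0 : ℝ), t ^ k * Real.exp (-((n + 1) * s.re) * t)
        = k.factorial / ((n + 1) * s.re) ^ (k + 1) := by
      apply Complex.ofReal_injective
      rw [h1]; push_cast; rfl
    rw [setIntegral_congr_fun (g := fun t =>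
      ‖s‖ ^ k * (t ^ k * Real.exp (-((n + 1) * s.re) * t))) measurableSet_Ioi, integral_const_mul,
      h3]
    · rw [mul_pow]
      have : (n : ℝ) + 1 ≠ 0 := by positivity
      field_simp
    · intro t ht
      simp only [F]
      rw [norm_mul, norm_pow, norm_pow_mul_exp_neg k _ ht]
      simp
  have hsum : Summable fun n => ∫ t in Ioi (0 : ℝ), ‖F n t‖ := by
    simp_rw [hnorm]
    refine Summable.mul_left _ ?_
    have := (summable_nat_add_iff 1).2 (Real.summable_one_div_nat_pow.2 (show 1 < k + 1 by omega))
    simpa using this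
  have h := integral_tsum_of_summable_integral_norm hF hsum
  have hl : ∫ t in Ioi (0 : ℝ), ∑' n, F n t = ∫ t in Ioi (0 : ℝ), bose k (t * s) := by
    refine setIntegral_congr_fun measurableSet_Ioi fun t ht => ?_
    have hts : 0 < ((t : ℂ) * s).re := by simpa using mul_pos ht hs
    have h4 := (hasSum_bose hk hts).tsum_eq
    simp only [F]
    rw [← h4]
    refine tsum_congr fun n => ?_
    rw [mul_pow, ← mul_assoc, mul_comm (s ^ k)]
    ring_nf
  rw [← hl, ← h]
  have hz := zeta_eq_tsum_one_div_nat_add_one_cpow (s := ((k + 1 : ℕ) : ℂ))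
    (by simp; omega)
  simp_rw [Complex.cpow_natCast] at hz
  push_cast at hz
  rw [hz, ← tsum_mul_left, ← tsum_div_const]
  refine tsum_congr fun n => ?_
  simp only [F]
  rw [integral_const_mul, integral_pow_mul_exp_neg k (hre n), mul_pow]
  have : (n : ℂ) + 1 ≠ 0 := Nat.cast_add_one_ne_zero n
  field_simp
  ring

/-- The successive derivatives of `t ↦ bose k (t * s)`. -/
def boseDeriv (k : ℕ) (s : ℂ) (n : ℕ) (t : ℝ) : ℂ := s ^ n * iteratedDeriv n (bose k) (t * s)

lemma mul_mem_sector {K : ℝ} {s : ℂ} (hs : ‖s‖ ≤ K * s.re) {t : ℝ} (ht : 0 ≤ t) :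
    ‖(t : ℂ) * s‖ ≤ K * ((t : ℂ) * s).re := by
  have h1 : ((t : ℂ) * s).re = t * s.re := by simp
  rw [h1, norm_mul, Complex.norm_real, Real.norm_of_nonneg ht]
  nlinarith

lemma hasDerivAt_boseDeriv {k : ℕ} {K : ℝ} (hK : 0 < K) {s : ℂ} (hs : ‖s‖ ≤ K * s.re)
    (n : ℕ) (t : ℝ) (ht : 0 ≤ t) :
    HasDerivAt (boseDeriv k s n) (boseDeriv k s (n + 1) t) t := by
  have hmem : (t : ℂ) * s ∈ boseDomain := mem_boseDomain_of_mem_sector (mul_mem_sector hs ht) hK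
  have h1 : HasDerivAt (iteratedDeriv n (bose k)) (iteratedDeriv (n + 1) (bose k) (t * s))
      (t * s) := by
    rw [iteratedDeriv_succ, iteratedDeriv_eq_iterate]
    exact (((analyticOnNhd_bose k).iterated_deriv n) _ hmem).differentiableAt.hasDerivAt
  have h2 : HasDerivAt (fun t : ℝ => (t : ℂ) * s) s t := by
    simpa using (hasDerivAt_id t).ofReal_comp.mul_const s
  refine ((h1.comp_of_eq t h2 rfl).const_mul (s ^ n)).congr_deriv ?_
  rw [boseDeriv, pow_succ]
  ring

/-- The factor |s|^n gained here makes the Euler–Maclaurin remainder small. -/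
lemma norm_boseDeriv_le {k : ℕ} {K C : ℝ} {s : ℂ} (hs : ‖s‖ ≤ K * s.re) {n : ℕ}
    (hC : ∀ x : ℂ, ‖x‖ ≤ K * x.re → ‖iteratedDeriv n (bose k) x‖ ≤ C / (1 + ‖x‖ ^ 2))
    (t : ℝ) (ht : 0 ≤ t) :
    ‖boseDeriv k s n t‖ ≤ ‖s‖ ^ n * C / (1 + (‖s‖ * t) ^ 2) := by
  have h := hC _ (mul_mem_sector hs ht)
  rw [norm_mul, Complex.norm_real, Real.norm_of_nonneg ht] at h
  rw [boseDeriv, norm_mul, norm_pow, mul_div_assoc, mul_comm ‖s‖ t]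
  gcongr

/-- The coefficient of `s ^ (2 * j)` in the expansion of
`s ^ (k + 1) * ∑ f ^ k / (exp (f * s) - 1)` at `s = 0`. -/
def emCoeff (k : ℕ) : ℕ → ℂ
  | 0 => k.factorial * riemannZeta (k + 1)
  | j + 1 => -(((bernoulliFun (2 * j + 2) 0 / (2 * j + 2).factorial : ℝ) : ℂ) *
      iteratedDeriv (2 * j + 1) (bose k) 0)

lemma tsum_bose_eq {k : ℕ} (hk : 1 ≤ k) {K : ℝ} (hK : 1 ≤ K) {s : ℂ} (hs0 : s ≠ 0)
    (hs : ‖s‖ ≤ K * s.re) (J : ℕ) :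
    s * ∑' f : ℕ, bose k ((f + 1) * s) =
      ∑ j ∈ Finset.range (J + 1), emCoeff k j * s ^ (2 * j) - (if k = 1 then 1 else 0) * (s / 2)
        + s * ∑' f, emTerm (boseDeriv k s) (2 * J + 1) f := by
  have hK0 : 0 < K := by linarith
  have hu := hasDerivAt_boseDeriv (k := k) hK0 hs
  have hc : 0 < ‖s‖ := norm_pos_iff.2 hs0
  have hD : ∀ n, ∃ D, 0 ≤ D ∧ ∀ t, 0 ≤ t → ‖boseDeriv k s n t‖ ≤ D / (1 + (‖s‖ * t) ^ 2) := by
    intro n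
    obtain ⟨C, hC0, hC⟩ := exists_norm_iteratedDeriv_bose_le hk hK n
    exact ⟨‖s‖ ^ n * C, by positivity, norm_boseDeriv_le hs hC⟩
  have h0 := tsum_emTerm_zero hu hc hD
  rw [tsum_emTerm_zero_eq_integral hu hc hD, tsum_emTerm_one hu hc hD J] at h0
  have hint : ∫ t in Ioi (0 : ℝ), boseDeriv k s 0 t = k.factorial * riemannZeta (k + 1) / s := by
    simp only [boseDeriv, pow_zero, one_mul, iteratedDeriv_zero]
    exact integral_bose hk (re_pos_of_mem_sector hK0 hs0 hs)
  rw [hint] at h0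
  have hsum : ∑' f : ℕ, boseDeriv k s 0 ((f : ℝ) + 1) = ∑' f : ℕ, bose k ((f + 1) * s) := by
    simp [boseDeriv]
  have hz : boseDeriv k s 0 0 = if k = 1 then 1 else 0 := by
    simp [boseDeriv, bose_zero hk]
  rw [hsum, hz] at h0
  have hcoef : ∑ j ∈ Finset.range (J + 1), emCoeff k j * s ^ (2 * j) =
      k.factorial * riemannZeta (k + 1) - s * ∑ i ∈ Finset.range J,
        ((bernoulliFun (2 * i + 2) 0 / (2 * i + 2).factorial : ℝ) : ℂ) *
          boseDeriv k s (2 * i + 1) 0 := by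
    rw [Finset.sum_range_succ', Finset.mul_sum, add_comm, sub_eq_add_neg, ← Finset.sum_neg_distrib]
    simp only [emCoeff, mul_zero, pow_zero, mul_one]
    congr 1
    refine Finset.sum_congr rfl fun i _ => ?_
    simp only [boseDeriv, ofReal_zero, zero_mul]
    ring
  rw [hcoef]
  rw [div_eq_iff hs0] at h0
  linear_combination -h0

/-- The expansion is taken one order further than needed, with J = N + 1. The crude bound on the
remainder sum gives away a factor |s|^2, and the extra main term has the order of the allowed error.
-/
lemma lambert_asymptotic {k : ℕ} (hk : 1 ≤ k) {K : ℝ} (hK : 1 ≤ K) (N : ℕ) :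
    ∃ C, 0 ≤ C ∧ ∀ s : ℂ, s ≠ 0 → ‖s‖ ≤ 1 → ‖s‖ ≤ K * s.re →
      ‖s * ∑' f : ℕ, bose k ((f + 1) * s) - (∑ j ∈ Finset.range (N + 1), emCoeff k j * s ^ (2 * j)
        - (if k = 1 then 1 else 0) * (s / 2))‖ ≤ C * ‖s‖ ^ (2 * N + 2) := by
  obtain ⟨D, hD0, hD⟩ := exists_norm_iteratedDeriv_bose_le hk hK (2 * (N + 1) + 1)
  obtain ⟨B, hB0, hB⟩ := exists_abs_bernoulliFun_div_le (2 * (N + 1) + 1)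
  set Z : ℝ := ∑' f : ℕ, (2 : ℝ) / (1 + (1 * f) ^ 2) with hZ
  have hZs := summable_div_one_add_sq one_pos 2
  have hZ0 : 0 ≤ Z := tsum_nonneg fun f => by positivity
  refine ⟨‖emCoeff k (N + 1)‖ + B * D * Z, by positivity, fun s hs0 hs1 hs => ?_⟩
  have hn0 : 0 < ‖s‖ := norm_pos_iff.2 hs0
  rw [tsum_bose_eq hk hK hs0 hs (N + 1), Finset.sum_range_succ _ (N + 1)]
  have hT : ‖∑' f, emTerm (boseDeriv k s) (2 * (N + 1) + 1) f‖ ≤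
      ‖s‖ ^ (2 * N + 1) * (B * D) * Z := by
    refine tsum_of_norm_bounded (hZs.hasSum.mul_left (‖s‖ ^ (2 * N + 1) * (B * D))) fun f => ?_
    refine (norm_emTerm_le hB0 (D := ‖s‖ ^ (2 * (N + 1) + 1) * D) (c := ‖s‖) (by positivity) hB
      (norm_boseDeriv_le hs hD) f).trans ?_
    -- Two powers of |s| buy a summable majorant independent of s, since |s| ≤ 1.
    have h1 : ‖s‖ ^ 2 * (1 / (1 + (‖s‖ * f) ^ 2)) ≤ 2 / (1 + (1 * (f : ℝ)) ^ 2) := by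
      rw [mul_one_div, div_le_div_iff₀ (by positivity) (by positivity)]
      nlinarith [mul_nonneg hn0.le (f.cast_nonneg (α := ℝ)), sq_nonneg (‖s‖ * f),
        pow_le_one₀ (n := 2) hn0.le hs1]
    calc B * (‖s‖ ^ (2 * (N + 1) + 1) * D / (1 + (‖s‖ * f) ^ 2))
        = ‖s‖ ^ (2 * N + 1) * (B * D) * (‖s‖ ^ 2 * (1 / (1 + (‖s‖ * f) ^ 2))) := by ring
      _ ≤ _ := by gcongr
  calc _ = ‖emCoeff k (N + 1) * s ^ (2 * (N + 1)) +
        s * ∑' f, emTerm (boseDeriv k s) (2 * (N + 1) + 1) f‖ := by congr 1; ring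
    _ ≤ ‖emCoeff k (N + 1)‖ * ‖s‖ ^ (2 * (N + 1)) +
        ‖s‖ * (‖s‖ ^ (2 * N + 1) * (B * D) * Z) := by
      refine (norm_add_le _ _).trans ?_
      rw [norm_mul, norm_pow, norm_mul]
      gcongr
    _ = _ := by ring

/-! ### The substitution b(ς) = exp(-s). -/

/-- The even function `H` with `log (1 + w) - log (1 - w) = w * H (w ^ 2)`. -/
def logQuot (z : ℂ) : ℂ := ∑' j : ℕ, 2 / (2 * j + 1) * z ^ j

lemma logQuot_zero : logQuot 0 = 2 := by
  rw [logQuot, tsum_eq_single 0 fun j hj => by simp [hj]]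
  simp

lemma differentiableOn_logQuot : DifferentiableOn ℂ logQuot (Metric.ball 0 (1 / 2)) := by
  refine Complex.differentiableOn_tsum_of_summable_norm (u := fun j : ℕ => 2 * (1 / 2 : ℝ) ^ j)
    (summable_geometric_two.mul_left 2) (fun j => by fun_prop) Metric.isOpen_ball ?_
  intro j z hz
  rw [mem_ball_zero_iff] at hz
  rw [norm_mul, norm_pow, norm_div]
  have h1 : ‖(2 * j + 1 : ℂ)‖ = 2 * j + 1 := by
    have : (2 * j + 1 : ℂ) = ((2 * j + 1 : ℕ) : ℂ) := by push_cast; rfl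
    rw [this, Complex.norm_natCast]; push_cast; rfl
  rw [h1, Complex.norm_ofNat]
  have h2 : (2 : ℝ) / (2 * j + 1) ≤ 2 := div_le_self (by norm_num) (by
    have := j.cast_nonneg (α := ℝ); linarith)
  gcongr

lemma analyticAt_logQuot : AnalyticAt ℂ logQuot 0 :=
  differentiableOn_logQuot.analyticAt (Metric.ball_mem_nhds 0 (by norm_num))

lemma log_sub_log_eq {w : ℂ} (hw : ‖w‖ < 1) : log (1 + w) - log (1 - w) = w * logQuot (w ^ 2) := by
  have h1 := hasSum_taylorSeries_neg_log hw
  have h2 := hasSum_taylorSeries_log hw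
  have h3 := h2.add h1
  rw [← sub_eq_add_neg] at h3
  have hinj : Function.Injective fun j : ℕ => 2 * j + 1 := fun a b h => by simpa using h
  have h4 : HasSum (fun j : ℕ => (2 / (2 * j + 1) * (w ^ 2) ^ j) * w) (log (1 + w) - log (1 - w)) := by
    rw [← hinj.hasSum_iff] at h3
    · convert! h3 using 1
      funext j
      have : (2 * j + 1 : ℂ) ≠ 0 := by exact_mod_cast Nat.succ_ne_zero (2 * j)
      simp only [Function.comp_apply]
      push_cast
      have hs : (-1 : ℂ) ^ (2 * j + 1 + 1) = 1 := Even.neg_one_pow ⟨j + 1, by ring⟩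
      rw [hs]
      field_simp
      ring
    · intro n hn
      have he : Even n := by
        by_contra h
        rw [Nat.not_even_iff_odd] at h
        obtain ⟨j, rfl⟩ := h
        exact hn ⟨j, rfl⟩
      rw [he.add_one.neg_one_pow]
      ring
  rw [← h4.tsum_eq, tsum_mul_right, logQuot, mul_comm]

lemma exp_neg_mul_logQuot {w : ℂ} (hw : ‖w‖ < 1) :
    exp (-(w * logQuot (w ^ 2))) = (1 - w) / (1 + w) := by
  have h1 : 1 + w ≠ 0 := fun h => by
    have : w = -1 := by linear_combination h
    simp [this] at hw
  have h2 : 1 - w ≠ 0 := fun h => by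
    have : w = 1 := by linear_combination -h
    simp [this] at hw
  rw [← log_sub_log_eq hw, neg_sub, Complex.exp_sub, Complex.exp_log h1, Complex.exp_log h2]

lemma sqrt_sq (z : ℂ) : Complex.sqrt z ^ 2 = z := by
  simp [Complex.sqrt]

lemma sqrt_ne_zero {z : ℂ} (hz : z ≠ 0) : Complex.sqrt z ≠ 0 := fun h => by
  have := sqrt_sq z
  rw [h] at this
  exact hz (by simpa using this.symm)

lemma re_sqrt_pos {z : ℂ} (hz : z ∈ slitPlane) : 0 < (Complex.sqrt z).re := by
  rw [Complex.sqrt, Complex.cpow_inv_two_re]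
  apply Real.sqrt_pos.2
  rcases hz with h | h
  · have := norm_nonneg z
    linarith
  · have := (abs_lt.1 (Complex.abs_re_lt_norm.2 h)).1
    linarith

lemma tsum_bose_eq_lambert {k : ℕ} (hk : 1 ≤ k) {s ς : ℂ} (hs0 : s ≠ 0) (hb : b ς = exp (-s)) :
    ∑' f : ℕ, bose k ((f + 1) * s) = s ^ k * ∑' f : ℕ, lambertTerm k ς (f + 1) := by
  rw [← tsum_mul_left]
  refine tsum_congr fun f => ?_
  have hf : ((f : ℂ) + 1) ≠ 0 := Nat.cast_add_one_ne_zero f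
  have hpow : exp (-s) ^ (f + 1) = (exp ((f + 1) * s))⁻¹ := by
    rw [← Complex.exp_nat_mul, ← Complex.exp_neg]
    push_cast
    ring_nf
  rw [bose_of_ne hk (mul_ne_zero hf hs0), lambertTerm, hb, hpow]
  have hE := Complex.exp_ne_zero ((f + 1) * s)
  -- At x = 1 both sides are 0 by the convention for division by zero, so no condition on exp is
  -- needed.
  have h1 : ∀ x : ℂ, x ≠ 0 → x⁻¹ / (1 - x⁻¹) = 1 / (x - 1) := by
    intro x hx
    by_cases h : x = 1
    · simp [h]
    · have h1 : x - 1 ≠ 0 := sub_ne_zero.2 h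
      have h2 : 1 - x⁻¹ ≠ 0 := by
        intro h3
        apply h
        rw [sub_eq_zero] at h3
        exact inv_eq_one.1 h3.symm
      field_simp
  rw [h1 _ hE, mul_pow]
  push_cast
  ring

lemma g_eq {k : ℕ} (hk : 1 ≤ k) {ς s : ℂ} (hς : 1 - ς ≠ 0) (hw : ‖Complex.sqrt (1 - ς)‖ < 1)
    (hH : logQuot (1 - ς) ≠ 0) (hs : s = Complex.sqrt (1 - ς) * logQuot (1 - ς)) :
    g k ς = (logQuot (1 - ς))⁻¹ ^ (k + 1) * (s * ∑' f : ℕ, bose k ((f + 1) * s)) := by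
  have hw0 := sqrt_ne_zero hς
  have hs0 : s ≠ 0 := hs ▸ mul_ne_zero hw0 hH
  have hb : b ς = exp (-s) := by
    have h := exp_neg_mul_logQuot hw
    rw [sqrt_sq, ← hs] at h
    rw [h, b]
  have hP : (logQuot (1 - ς))⁻¹ ^ (k + 1) * logQuot (1 - ς) ^ (k + 1) = 1 := by
    rw [← mul_pow, inv_mul_cancel₀ hH, one_pow]
  rw [tsum_bose_eq_lambert hk hs0 hb, g, hs]
  linear_combination
    (-(Complex.sqrt (1 - ς) ^ (k + 1) * ∑' f : ℕ, lambertTerm k ς (f + 1))) * hP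

/-! ### Taylor truncation and the correction coefficients. -/

/-- The Taylor coefficients of `f` at `0`. -/
def taylorCoeff (f : ℂ → ℂ) (i : ℕ) : ℂ := iteratedDeriv i f 0 / i.factorial

lemma taylorCoeff_zero (f : ℂ → ℂ) : taylorCoeff f 0 = f 0 := by simp [taylorCoeff]

lemma isBigO_sub_taylor {f : ℂ → ℂ} (hf : AnalyticAt ℂ f 0) (n : ℕ) :
    (fun z => f z - ∑ i ∈ Finset.range n, taylorCoeff f i * z ^ i) =O[𝓝 0] fun z => z ^ n := by
  have h := hf.hasFPowerSeriesAt.isBigO_sub_partialSum_pow n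
  refine IsBigO.of_norm_right (h.congr (fun z => ?_) fun z => (norm_pow z n).symm)
  simp [FormalMultilinearSeries.partialSum, taylorCoeff, mul_comm]

/-- The factor `H ^ (2 * j) / H ^ (k + 1)` of the `j`-th term of the expansion. -/
def expFactor (k j : ℕ) (z : ℂ) : ℂ := (logQuot z)⁻¹ ^ (k + 1) * logQuot z ^ (2 * j)

lemma analyticAt_inv_logQuot : AnalyticAt ℂ (fun z => (logQuot z)⁻¹) 0 :=
  analyticAt_logQuot.inv (by rw [logQuot_zero]; norm_num)

lemma analyticAt_expFactor (k j : ℕ) : AnalyticAt ℂ (expFactor k j) 0 :=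
  (analyticAt_inv_logQuot.pow (k + 1)).mul (analyticAt_logQuot.pow (2 * j))

/-- The coefficients of the polynomial correction. -/
def lamCoeff (k l : ℕ) : ℂ :=
  -∑ j ∈ Finset.range (l + 1), emCoeff k j * taylorCoeff (expFactor k j) (l - j)

/-- The coefficients of the correction by `√(1 - ς)` times a polynomial. -/
def lamCoeff' (l : ℕ) : ℂ := taylorCoeff (fun z => (logQuot z)⁻¹ / 2) l

/-- The j-th term s^(2j) H^(-(k+1)) equals z^j times `expFactor k j z`, so collecting by total
degree l = i + j gives a coefficient using only j ≤ l, independent of M. The constant subtracted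
from g_k is the degree 0 part, because H(0) = 2. -/
lemma sum_lamCoeff_eq (k M : ℕ) (z : ℂ) :
    (k.factorial : ℂ) * riemannZeta (k + 1) / 2 ^ (k + 1)
      - ∑ l ∈ Finset.Icc 1 M, lamCoeff k l * z ^ l =
    ∑ j ∈ Finset.range (M + 1), emCoeff k j * (z ^ j *
      ∑ i ∈ Finset.range (M + 1 - j), taylorCoeff (expFactor k j) i * z ^ i) := by
  have h0 : (k.factorial : ℂ) * riemannZeta (k + 1) / 2 ^ (k + 1) = -lamCoeff k 0 * z ^ 0 := by
    simp [lamCoeff, emCoeff, taylorCoeff_zero, expFactor, logQuot_zero, div_eq_mul_inv]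
  have h1 : ∑ l ∈ Finset.Icc 1 M, lamCoeff k l * z ^ l =
      ∑ l ∈ Finset.range M, lamCoeff k (l + 1) * z ^ (l + 1) := by
    rw [Finset.range_eq_Ico, Finset.sum_Ico_add' (fun l => lamCoeff k l * z ^ l) 0 M 1]
    rfl
  calc _ = ∑ l ∈ Finset.range (M + 1), -lamCoeff k l * z ^ l := by
        rw [Finset.sum_range_succ', h0, h1]
        simp only [neg_mul, Finset.sum_neg_distrib]
        ring
    _ = ∑ l ∈ Finset.range (M + 1), ∑ j ∈ Finset.range (l + 1),
          emCoeff k j * (z ^ j * (taylorCoeff (expFactor k j) (l - j) * z ^ (l - j))) := by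
        refine Finset.sum_congr rfl fun l _ => ?_
        rw [lamCoeff, neg_neg, Finset.sum_mul]
        refine Finset.sum_congr rfl fun j hj => ?_
        have : l = j + (l - j) := by have := Finset.mem_range.1 hj; omega
        conv_lhs => rw [this, pow_add, ← this]
        ring
    _ = _ := by
        rw [Finset.sum_range_diag_flip (M + 1) fun j i =>
          emCoeff k j * (z ^ j * (taylorCoeff (expFactor k j) i * z ^ i))]
        simp only [Finset.mul_sum]

lemma isBigO_even_part (k M : ℕ) :
    (fun z : ℂ => ∑ j ∈ Finset.range (M + 1), emCoeff k j * (z ^ j * expFactor k j z)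
      - ((k.factorial : ℂ) * riemannZeta (k + 1) / 2 ^ (k + 1)
      - ∑ l ∈ Finset.Icc 1 M, lamCoeff k l * z ^ l)) =O[𝓝 0] fun z => z ^ (M + 1) := by
  simp_rw [sum_lamCoeff_eq, ← Finset.sum_sub_distrib, ← mul_sub]
  refine IsBigO.fun_sum fun j hj => IsBigO.const_mul_left ?_ _
  have h := (isBigO_refl (fun z : ℂ => z ^ j) (𝓝 0)).mul
    (isBigO_sub_taylor (analyticAt_expFactor k j) (M + 1 - j))
  refine h.congr_right fun z => ?_
  rw [← pow_add]
  congr 1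
  have := Finset.mem_range.1 hj
  omega

/-- For k = 1 the term -s/2, multiplied by H^(-2), becomes -w/(2H). The constant 1/4 is 1/(2H(0)).
-/
lemma isBigO_odd_part (M : ℕ) :
    (fun z : ℂ => 1 / 4 + ∑ l ∈ Finset.Icc 1 M, lamCoeff' l * z ^ l - (logQuot z)⁻¹ / 2)
      =O[𝓝 0] fun z => z ^ (M + 1) := by
  have h := (isBigO_sub_taylor (f := fun z => (logQuot z)⁻¹ / 2)
    (analyticAt_inv_logQuot.div_const) (M + 1)).neg_left
  refine h.congr_left fun z => ?_
  have h1 : ∑ l ∈ Finset.Icc 1 M, lamCoeff' l * z ^ l =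
      ∑ l ∈ Finset.range M, lamCoeff' (l + 1) * z ^ (l + 1) := by
    rw [Finset.range_eq_Ico, Finset.sum_Ico_add' (fun l => lamCoeff' l * z ^ l) 0 M 1]
    rfl
  rw [Finset.sum_range_succ', h1, taylorCoeff_zero, logQuot_zero]
  simp only [lamCoeff']
  ring

/-! ### Size of the corrected function near ς = 1. -/

lemma exists_norm_wp_le {k : ℕ} (hk : 1 ≤ k) (M : ℕ) :
    ∃ C r : ℝ, 0 ≤ C ∧ 0 < r ∧ ∀ ς : ℂ, 1 - ς ≠ 0 → ‖1 - ς‖ < r →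
      ‖Complex.sqrt (1 - ς)‖ ≤ 2 * (Complex.sqrt (1 - ς)).re →
      ‖wp M k (lamCoeff k) lamCoeff' ς‖ ≤ C * ‖Complex.sqrt (1 - ς)‖ ^ (2 * M + 1) := by
  obtain ⟨C₁, hC₁⟩ := (isBigO_even_part k M).bound
  obtain ⟨C₂, hC₂⟩ := (isBigO_odd_part M).bound
  -- With |H - 2| < 1/2 and |w| ≤ 2 Re w one gets |s| ≤ (5/2)|w| and Re s ≥ |w|/2, hence the sector
  -- constant 5.
  obtain ⟨C₃, hC₃0, hC₃⟩ := lambert_asymptotic hk (K := 5) (by norm_num) M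
  have hH : ∀ᶠ z in 𝓝 (0 : ℂ), ‖logQuot z - 2‖ < 1 / 2 := by
    have h := analyticAt_logQuot.continuousAt
    rw [Metric.continuousAt_iff'] at h
    simpa [dist_eq_norm, logQuot_zero] using h (1 / 2) (by norm_num)
  obtain ⟨r, hr0, hr⟩ := Metric.eventually_nhds_iff.1 (hC₁.and (hC₂.and hH))
  -- The radius 1/9 forces |w| < 1/3, so |s| < 1.
  refine ⟨|C₁| + |C₂| + C₃ * 3 ^ (2 * M + 2), min r (1 / 9), by positivity,
    by positivity, fun ς hς hςr hsec => ?_⟩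
  obtain ⟨h1, h2, h3⟩ := hr (y := 1 - ς) (by
    rw [dist_zero_right]; exact hςr.trans_le (min_le_left _ _))
  set z := 1 - ς with hz
  set w := Complex.sqrt z with hw
  have hwz : w ^ 2 = z := sqrt_sq z
  have hwn : ‖w‖ ^ 2 = ‖z‖ := by rw [← norm_pow, hwz]
  have hz9 : ‖z‖ < 1 / 9 := hςr.trans_le (min_le_right _ _)
  have hw3 : ‖w‖ < 1 / 3 := by nlinarith [norm_nonneg w]
  have hw0 : w ≠ 0 := sqrt_ne_zero hς
  have hH0 : logQuot z ≠ 0 := fun h => by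
    rw [h] at h3; norm_num at h3
  set s := w * logQuot z with hs
  have hs0 : s ≠ 0 := mul_ne_zero hw0 hH0
  have hHn : ‖logQuot z‖ ≤ 5 / 2 := by
    have := norm_add_le (logQuot z - 2) 2
    rw [sub_add_cancel, Complex.norm_ofNat] at this
    linarith
  have hHn' : 1 ≤ ‖logQuot z‖ := by
    have := norm_sub_le (logQuot z - 2) (logQuot z)
    rw [sub_sub_cancel_left, norm_neg, Complex.norm_ofNat] at this
    linarith
  have hsn : ‖s‖ ≤ 5 / 2 * ‖w‖ := by
    rw [hs, norm_mul, mul_comm]; gcongr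
  have hsre : ‖w‖ / 2 ≤ s.re := by
    have e : s = 2 * w + w * (logQuot z - 2) := by rw [hs]; ring
    have h4 := (abs_le.1 (Complex.abs_re_le_norm (w * (logQuot z - 2)))).1
    rw [norm_mul] at h4
    have h5 : ‖w‖ * ‖logQuot z - 2‖ ≤ ‖w‖ * (1 / 2) := by gcongr
    have h6 : s.re = 2 * w.re + (w * (logQuot z - 2)).re := by
      rw [e, add_re]; simp
    linarith
  have h4 := hC₃ s hs0 (by linarith) (by linarith)
  have hg := g_eq hk hς (by rw [← hz, ← hw]; linarith) hH0 hs
  rw [← hz] at hg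
  set S := s * ∑' f : ℕ, bose k ((f + 1) * s) with hS
  set P := (logQuot z)⁻¹ with hP
  have hPH : P * logQuot z = 1 := inv_mul_cancel₀ hH0
  have hPn : ‖P‖ ≤ 1 := by rw [hP, norm_inv]; exact inv_le_one_of_one_le₀ hHn'
  have hmain : P ^ (k + 1) * ∑ j ∈ Finset.range (M + 1), emCoeff k j * s ^ (2 * j) =
      ∑ j ∈ Finset.range (M + 1), emCoeff k j * (z ^ j * expFactor k j z) := by
    rw [Finset.mul_sum]
    refine Finset.sum_congr rfl fun j _ => ?_
    rw [hs, mul_pow, pow_mul w, hwz, expFactor, hP]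
    ring
  have hodd : P ^ (k + 1) * ((if k = 1 then 1 else 0) * (s / 2)) =
      (if k = 1 then 1 else 0) * (w * (P / 2)) := by
    split_ifs with h
    · rw [h, hs]
      linear_combination (w * P / 2) * hPH
    · simp
  have hwp : wp M k (lamCoeff k) lamCoeff' ς =
      P ^ (k + 1) * (S - (∑ j ∈ Finset.range (M + 1), emCoeff k j * s ^ (2 * j)
        - (if k = 1 then 1 else 0) * (s / 2)))
      + (∑ j ∈ Finset.range (M + 1), emCoeff k j * (z ^ j * expFactor k j z)
      - ((k.factorial : ℂ) * riemannZeta (k + 1) / 2 ^ (k + 1)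
      - ∑ l ∈ Finset.Icc 1 M, lamCoeff k l * z ^ l))
      + (if k = 1 then 1 else 0) *
        (w * (1 / 4 + ∑ l ∈ Finset.Icc 1 M, lamCoeff' l * z ^ l - P / 2)) := by
    rw [← hmain, wp, hg, ← hz, ← hw]
    linear_combination -hodd
  rw [norm_pow, ← hwn] at h1 h2
  have hwM : ‖w‖ ^ (2 * M + 2) ≤ ‖w‖ ^ (2 * M + 1) :=
    pow_le_pow_of_le_one (norm_nonneg _) (by linarith) (by omega)
  have hT1 : ‖P ^ (k + 1) * (S - (∑ j ∈ Finset.range (M + 1), emCoeff k j * s ^ (2 * j)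
        - (if k = 1 then 1 else 0) * (s / 2)))‖ ≤ C₃ * 3 ^ (2 * M + 2) * ‖w‖ ^ (2 * M + 1) := by
    rw [norm_mul, norm_pow]
    calc _ ≤ 1 * (C₃ * (3 * ‖w‖) ^ (2 * M + 2)) := by
          refine mul_le_mul (pow_le_one₀ (norm_nonneg _) hPn) (h4.trans ?_) (norm_nonneg _)
            zero_le_one
          have : ‖s‖ ≤ 3 * ‖w‖ := by linarith [norm_nonneg w]
          gcongr
      _ = C₃ * 3 ^ (2 * M + 2) * ‖w‖ ^ (2 * M + 2) := by rw [mul_pow]; ring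
      _ ≤ _ := by gcongr
  have hT2 : ‖∑ j ∈ Finset.range (M + 1), emCoeff k j * (z ^ j * expFactor k j z)
      - ((k.factorial : ℂ) * riemannZeta (k + 1) / 2 ^ (k + 1)
      - ∑ l ∈ Finset.Icc 1 M, lamCoeff k l * z ^ l)‖ ≤ |C₁| * ‖w‖ ^ (2 * M + 1) := by
    refine h1.trans ?_
    rw [← pow_mul, mul_add, mul_one]
    gcongr
    exact le_abs_self _
  have hT3 : ‖(if k = 1 then 1 else 0 : ℂ) *
        (w * (1 / 4 + ∑ l ∈ Finset.Icc 1 M, lamCoeff' l * z ^ l - P / 2))‖ ≤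
      |C₂| * ‖w‖ ^ (2 * M + 1) := by
    rw [norm_mul, norm_mul]
    have hδ : ‖(if k = 1 then 1 else 0 : ℂ)‖ ≤ 1 := by split_ifs <;> simp
    calc _ ≤ 1 * (1 * (|C₂| * ‖w‖ ^ (2 * M + 1))) := by
          gcongr
          · linarith
          · refine h2.trans ?_
            rw [← pow_mul, mul_add, mul_one]
            gcongr
            exact le_abs_self _
      _ = _ := by ring
  rw [hwp]
  refine norm_add₃_le.trans ?_
  linarith

/-! ### Convergence and holomorphy off [1, ∞). -/

lemma norm_lambert_le (k : ℕ) {r : ℝ} (hr : r < 1) {q : ℂ} (hq : ‖q‖ ≤ r) (f : ℕ) :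
    ‖((f + 1 : ℕ) : ℂ) ^ k * (q ^ (f + 1) / (1 - q ^ (f + 1)))‖ ≤
      ((f + 1 : ℕ) : ℝ) ^ k * r ^ (f + 1) * (1 - r)⁻¹ := by
  have hr0 : 0 ≤ r := (norm_nonneg q).trans hq
  have h1 : ‖q ^ (f + 1)‖ ≤ r ^ (f + 1) := by rw [norm_pow]; gcongr
  have h2 : r ^ (f + 1) ≤ r := pow_le_of_le_one hr0 hr.le (by omega)
  have h3 : 1 - r ≤ ‖1 - q ^ (f + 1)‖ := by
    have := norm_sub_norm_le 1 (q ^ (f + 1))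
    rw [norm_one] at this
    linarith
  have h4 : 0 < 1 - r := by linarith
  rw [norm_mul, norm_pow, Complex.norm_natCast, norm_div, mul_assoc, div_eq_mul_inv]
  gcongr

lemma summable_lambert_bound (k : ℕ) {r : ℝ} (hr0 : 0 ≤ r) (hr : r < 1) :
    Summable fun f : ℕ => ((f + 1 : ℕ) : ℝ) ^ k * r ^ (f + 1) * (1 - r)⁻¹ := by
  refine Summable.mul_right _ ?_
  have h := summable_pow_mul_geometric_of_norm_lt_one (R := ℝ) k (r := r)
    (by rwa [Real.norm_of_nonneg hr0])
  exact (summable_nat_add_iff (f := fun n : ℕ => (n : ℝ) ^ k * r ^ n) 1).2 h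

lemma differentiableOn_lambert (k : ℕ) :
    DifferentiableOn ℂ (fun q : ℂ => ∑' f : ℕ, ((f + 1 : ℕ) : ℂ) ^ k *
      (q ^ (f + 1) / (1 - q ^ (f + 1)))) (Metric.ball 0 1) := by
  intro q hq
  rw [mem_ball_zero_iff] at hq
  obtain ⟨r, hqr, hr⟩ := exists_between hq
  have hr0 : 0 ≤ r := (norm_nonneg q).trans hqr.le
  have h := Complex.differentiableOn_tsum_of_summable_norm (U := Metric.ball (0 : ℂ) r)
    (F := fun (f : ℕ) (q : ℂ) => ((f + 1 : ℕ) : ℂ) ^ k * (q ^ (f + 1) / (1 - q ^ (f + 1))))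
    (summable_lambert_bound k hr0 hr) (fun f => ?_) Metric.isOpen_ball
    (fun f w hw => norm_lambert_le k hr (mem_ball_zero_iff.1 hw).le f)
  · exact (h.differentiableAt
      (Metric.isOpen_ball.mem_nhds (mem_ball_zero_iff.2 hqr))).differentiableWithinAt
  · refine (DifferentiableOn.div (by fun_prop) (by fun_prop) fun w hw h0 => ?_).const_mul _
    rw [mem_ball_zero_iff] at hw
    have h1 : ‖w ^ (f + 1)‖ < 1 := by
      rw [norm_pow]
      exact pow_lt_one₀ (norm_nonneg _) (hw.trans hr) (by omega)
    rw [← sub_eq_zero.1 h0] at h1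
    simp at h1

/-- The complement of `[1, ∞)`. -/
def slitDomain : Set ℂ := {ς | 1 - ς ∈ slitPlane}

lemma isOpen_slitDomain : IsOpen slitDomain :=
  isOpen_slitPlane.preimage (by fun_prop)

lemma one_add_sqrt_ne_zero {ς : ℂ} (hς : ς ∈ slitDomain) : 1 + Complex.sqrt (1 - ς) ≠ 0 := by
  intro h
  have h1 := re_sqrt_pos hς
  have h2 := congrArg Complex.re h
  rw [add_re, one_re, zero_re] at h2
  linarith

/-- A point w with Re w > 0 is closer to 1 than to -1. -/
lemma norm_b_lt_one {ς : ℂ} (hς : ς ∈ slitDomain) : ‖b ς‖ < 1 := by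
  have h1 := re_sqrt_pos hς
  rw [b, norm_div, div_lt_one (norm_pos_iff.2 (one_add_sqrt_ne_zero hς))]
  refine lt_of_pow_lt_pow_left₀ 2 (norm_nonneg _) ?_
  rw [← Complex.normSq_eq_norm_sq, ← Complex.normSq_eq_norm_sq, Complex.normSq_apply,
    Complex.normSq_apply]
  simp only [sub_re, sub_im, add_re, add_im, one_re, one_im]
  linarith

lemma differentiableOn_sqrt_one_sub :
    DifferentiableOn ℂ (fun ς => Complex.sqrt (1 - ς)) slitDomain :=
  Complex.differentiableOn_sqrt.comp (by fun_prop) fun _ h => h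

lemma differentiableOn_b : DifferentiableOn ℂ b slitDomain :=
  DifferentiableOn.div (differentiableOn_sqrt_one_sub.const_sub 1)
    (differentiableOn_sqrt_one_sub.const_add 1) fun _ h => one_add_sqrt_ne_zero h

lemma summable_lambertTerm (k : ℕ) {ς : ℂ} (hς : ς ∈ slitDomain) :
    Summable fun f : ℕ => lambertTerm k ς (f + 1) :=
  Summable.of_norm_bounded (summable_lambert_bound k (norm_nonneg _) (norm_b_lt_one hς))
    fun f => norm_lambert_le k (norm_b_lt_one hς) le_rfl f

lemma differentiableOn_g (k : ℕ) : DifferentiableOn ℂ (g k) slitDomain :=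
  (differentiableOn_sqrt_one_sub.pow (k + 1)).mul
    ((differentiableOn_lambert k).comp differentiableOn_b fun _ h =>
      mem_ball_zero_iff.2 (norm_b_lt_one h))

lemma differentiableOn_wp (M k : ℕ) (lam lam' : ℕ → ℂ) :
    DifferentiableOn ℂ (wp M k lam lam') slitDomain := by
  have hpoly : ∀ l : ℕ → ℂ, DifferentiableOn ℂ
      (fun ς : ℂ => ∑ i ∈ Finset.Icc 1 M, l i * (1 - ς) ^ i) slitDomain := fun l => by fun_prop
  exact (((differentiableOn_g k).sub_const _).add (hpoly lam)).add
    ((differentiableOn_sqrt_one_sub.mul ((hpoly lam').const_add _)).const_mul _)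

/-! ### Sectors and Cauchy estimates at ς = 1. -/

lemma re_one_sub_pos {ς : ℂ} (hς : ‖ς‖ ≤ 1) (h1 : ς ≠ 1) : 0 < (1 - ς).re := by
  rw [sub_re, one_re]
  by_contra! h
  have h2 := Complex.re_le_norm ς
  have hre : ς.re = 1 := by linarith
  have h3 : Complex.normSq ς ≤ 1 := by
    rw [Complex.normSq_eq_norm_sq]; exact pow_le_one₀ (norm_nonneg _) hς
  rw [Complex.normSq_apply, hre] at h3
  have him : ς.im = 0 := by nlinarith
  exact h1 (Complex.ext hre him)

lemma mem_slitDomain_of_norm_le {ς : ℂ} (hς : ‖ς‖ ≤ 1) (h1 : ς ≠ 1) : ς ∈ slitDomain :=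
  Or.inl (re_one_sub_pos hς h1)

/-- For w = √z the hypothesis reads (Im w)^2 ≤ 2 (Re w)^2, which is more than enough. -/
lemma norm_sqrt_le_of_re {z : ℂ} (hz : -‖z‖ ≤ 3 * z.re) :
    ‖Complex.sqrt z‖ ≤ 2 * (Complex.sqrt z).re := by
  have h0 : 0 ≤ (Complex.sqrt z).re := by
    rw [Complex.sqrt, Complex.cpow_inv_two_re]; positivity
  set w := Complex.sqrt z with hw
  have hwz : w ^ 2 = z := sqrt_sq z
  have hn : ‖z‖ = w.re * w.re + w.im * w.im := by
    rw [← hwz, norm_pow, ← Complex.normSq_eq_norm_sq, Complex.normSq_apply]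
  have hre : z.re = w.re * w.re - w.im * w.im := by rw [← hwz, sq, mul_re]
  refine le_of_sq_le_sq ?_ (by positivity)
  rw [← Complex.normSq_eq_norm_sq, Complex.normSq_apply]
  nlinarith

/-- On a disc of radius `‖z‖ / 4` around a point `z` of the right half-plane, the square root
stays in a fixed sector. -/
lemma sector_of_mem_closedBall {z z' : ℂ} (hz : 0 < z.re) (h : ‖z' - z‖ ≤ ‖z‖ / 4) :
    z' ∈ slitPlane ∧ ‖Complex.sqrt z'‖ ≤ 2 * (Complex.sqrt z').re ∧
      ‖Complex.sqrt z'‖ ≤ 2 * ‖Complex.sqrt z‖ := by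
  have hz0 : 0 < ‖z‖ := norm_pos_iff.2 fun h => by simp [h] at hz
  have h1 : 3 / 4 * ‖z‖ ≤ ‖z'‖ := by
    have := norm_sub_norm_le z z'
    rw [norm_sub_rev] at this
    linarith
  have h1' : ‖z'‖ ≤ 5 / 4 * ‖z‖ := by
    have := norm_sub_norm_le z' z
    linarith
  have h2 : -(‖z‖ / 4) ≤ z'.re := by
    have := (abs_le.1 ((Complex.abs_re_le_norm (z' - z)).trans h)).1
    rw [sub_re] at this
    linarith
  refine ⟨?_, norm_sqrt_le_of_re (by linarith), ?_⟩
  · by_contra hn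
    rw [Complex.mem_slitPlane_iff] at hn
    push Not at hn
    have h3 : ‖z'‖ = |z'.re| := (Complex.abs_re_eq_norm.2 hn.2).symm
    rw [abs_of_nonpos hn.1] at h3
    linarith
  · refine le_of_sq_le_sq ?_ (by positivity)
    rw [mul_pow, ← norm_pow, ← norm_pow, sqrt_sq, sqrt_sq]
    linarith

/-- The Cauchy disc of radius |1 - ς|/4 may leave the unit disc, which is why the bound on the
function was proved in a sector. Dividing |w|^(2M+1) by |w|^(2m) leaves at least one factor |w|. -/
lemma exists_norm_iteratedDeriv_wp_le {k : ℕ} (hk : 1 ≤ k) {M m : ℕ} (hm : m ≤ M) :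
    ∃ C r : ℝ, 0 < r ∧ ∀ ς : ℂ, ‖ς‖ ≤ 1 → ς ≠ 1 → ‖1 - ς‖ < r →
      ‖iteratedDeriv m (wp M k (lamCoeff k) lamCoeff') ς‖ ≤ C * ‖Complex.sqrt (1 - ς)‖ := by
  obtain ⟨C, r, hC0, hr, hC⟩ := exists_norm_wp_le hk M
  refine ⟨m.factorial * (C * 2 ^ (2 * M + 1)) * 4 ^ m, min (r / 2) 1, by positivity,
    fun ς hς h1 hςr => ?_⟩
  have hr2 : ‖1 - ς‖ < r / 2 := hςr.trans_le (min_le_left _ _)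
  have hle1 : ‖1 - ς‖ < 1 := hςr.trans_le (min_le_right _ _)
  have hre := re_one_sub_pos hς h1
  have hz0 : 0 < ‖1 - ς‖ := norm_pos_iff.2 (sub_ne_zero.2 h1.symm)
  set w := Complex.sqrt (1 - ς) with hw
  have hwn : ‖w‖ ^ 2 = ‖1 - ς‖ := by rw [← norm_pow, hw, sqrt_sq]
  have hw0 : 0 < ‖w‖ := norm_pos_iff.2 (sqrt_ne_zero (norm_pos_iff.1 hz0))
  have hw1 : ‖w‖ ≤ 1 := by nlinarith
  have hsec : ∀ y ∈ Metric.closedBall ς (‖1 - ς‖ / 4), _ := fun y hy =>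
    sector_of_mem_closedBall (z := 1 - ς) (z' := 1 - y) hre (by
      rw [Metric.mem_closedBall, dist_eq_norm] at hy
      rwa [sub_sub_sub_cancel_left, norm_sub_rev])
  have hd := Complex.norm_iteratedDeriv_le_of_forall_mem_sphere_norm_le (c := ς)
    (R := ‖1 - ς‖ / 4) (C := C * (2 * ‖w‖) ^ (2 * M + 1))
    (f := wp M k (lamCoeff k) lamCoeff') m (by positivity)
    (((differentiableOn_wp M k _ _).mono fun y hy =>
      (hsec y (Metric.closure_ball_subset_closedBall hy)).1).diffContOnCl)
    (fun y hy => by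
      have hy' := Metric.sphere_subset_closedBall hy
      obtain ⟨h2, h3, h4⟩ := hsec y hy'
      refine (hC y (slitPlane_ne_zero h2) ?_ h3).trans ?_
      · rw [Metric.mem_closedBall, dist_eq_norm] at hy'
        have := norm_sub_le (1 - ς) (y - ς)
        rw [sub_sub_sub_cancel_right] at this
        linarith
      · gcongr)
  refine hd.trans ?_
  rw [← hwn, div_pow, ← pow_mul]
  have h5 : ‖w‖ ^ (2 * M + 1) ≤ ‖w‖ ^ (2 * m + 1) :=
    pow_le_pow_of_le_one (norm_nonneg _) hw1 (by omega)
  rw [div_le_iff₀ (by positivity)]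
  calc _ = m.factorial * (C * 2 ^ (2 * M + 1)) * ‖w‖ ^ (2 * M + 1) := by rw [mul_pow]; ring
    _ ≤ m.factorial * (C * 2 ^ (2 * M + 1)) * ‖w‖ ^ (2 * m + 1) := by gcongr
    _ = _ := by field_simp; ring

end

end ClosedWalk

/-! ### Continuous extension to the closed disc. -/

theorem mainTheorem6 :
    ∃ lam lam' : ℕ → ℕ → ℂ, ∀ M : ℕ, 2 ≤ M → ∀ k : ℕ, 1 ≤ k →
      (∀ ς ∈ Metric.ball (0 : ℂ) 1, Summable fun f : ℕ => ClosedWalk.lambertTerm k ς (f + 1)) ∧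
      DifferentiableOn ℂ (ClosedWalk.wp M k (lam k) (lam' k)) (Metric.ball 0 1) ∧
      ∀ m : ℕ, m ≤ M → ∃ F : ℂ → ℂ,
        ContinuousOn F (Metric.closedBall 0 1) ∧
        (∀ ς ∈ Metric.ball (0 : ℂ) 1,
          F ς = iteratedDeriv m (ClosedWalk.wp M k (lam k) (lam' k)) ς) ∧
        F 1 = 0 := by
  refine ⟨ClosedWalk.lamCoeff, fun _ => ClosedWalk.lamCoeff', fun M _ k hk => ?_⟩
  have hne : ∀ ς ∈ Metric.ball (0 : ℂ) 1, ς ≠ 1 := by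
    rintro ς hς rfl
    simp at hς
  have hball : Metric.ball (0 : ℂ) 1 ⊆ ClosedWalk.slitDomain := fun ς hς =>
    ClosedWalk.mem_slitDomain_of_norm_le (mem_ball_zero_iff.1 hς).le (hne ς hς)
  refine ⟨fun ς hς => ClosedWalk.summable_lambertTerm k (hball hς),
    (ClosedWalk.differentiableOn_wp M k _ _).mono hball, fun m hm => ?_⟩
  set D := iteratedDeriv m (ClosedWalk.wp M k (ClosedWalk.lamCoeff k) ClosedWalk.lamCoeff')
    with hD
  -- Away from 1 the closed disc lies in the domain of holomorphy, so the derivative itself is the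
  -- extension; only its value at the branch point is reset.
  refine ⟨Function.update D 1 0, ?_, fun ς hς => Function.update_of_ne (hne ς hς) _ _,
    Function.update_self _ _ _⟩
  intro ς hς
  rw [mem_closedBall_zero_iff] at hς
  by_cases h1 : ς = 1
  · subst h1
    obtain ⟨C, r, hr, hC⟩ := ClosedWalk.exists_norm_iteratedDeriv_wp_le hk hm
    rw [continuousWithinAt_update_same]
    have hlim : Tendsto (fun ς : ℂ => C * ‖Complex.sqrt (1 - ς)‖) (𝓝 1) (𝓝 0) := by
      have h2 : ContinuousAt (fun ς : ℂ => C * ‖Complex.sqrt (1 - ς)‖) 1 := by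
        refine continuousAt_const.mul (ContinuousAt.norm ?_)
        exact ContinuousAt.comp (g := Complex.sqrt) (f := fun ς : ℂ => 1 - ς)
          (Complex.continuousAt_sqrt (by simp)) (by fun_prop)
      simpa [ContinuousAt] using h2
    refine squeeze_zero_norm' ?_ (hlim.mono_left nhdsWithin_le_nhds)
    have hr' : Metric.ball (1 : ℂ) r ∈ 𝓝[Metric.closedBall 0 1 \ {1}] (1 : ℂ) :=
      mem_nhdsWithin_of_mem_nhds (Metric.ball_mem_nhds 1 hr)
    filter_upwards [hr', self_mem_nhdsWithin] with ς h2 h3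
    rw [Metric.mem_ball, dist_comm, dist_eq_norm] at h2
    exact hC ς (mem_closedBall_zero_iff.1 h3.1) h3.2 h2
  · have hmem := ClosedWalk.mem_slitDomain_of_norm_le hς h1
    refine ContinuousAt.continuousWithinAt ?_
    rw [continuousAt_update_of_ne h1, hD, iteratedDeriv_eq_iterate]
    exact ((((ClosedWalk.differentiableOn_wp M k _ _).analyticOnNhd
      ClosedWalk.isOpen_slitDomain).iterated_deriv m) ς hmem).continuousAt
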